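/- Let $k$ be an algebraically closed field of characteristic $0$ and let $H$ be a Hopf algebra over $k$ whose underlying ring is semisimple (Artinian). 1. If $H$ is commutative, then there exists a finite group $G$ such that $H\simeq k[G]^*$ as Hopf algebras. 2. If $H$ is cocommutative, then there exists a finite group $G$ such that $H\simeq k[G]$ as Hopf algebras. Here $k[G]$ is the group algebra with $\Delta(g)=g\otimes g$, $\varepsilon(g)=1$, $S(g)=g^{-1}$ for $g\in G$, and $k[G]^*=\mathrm{Hom}_k(k[G],k)$ is its dual Hopf algebra: the multiplication is convolution, the unit is the counit of $k[G]$, and comultiplication, counit and antipode are the transposes of the multiplication, unit and antipode of $k[G]$. -/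

import Mathlib

open scoped TensorProduct

namespace HopfDual

open Coalgebra WithConv

/-- The linear dual `H^* = Hom_k(H, k)`, with the convolution algebra structure
`(f * g)(x) = ∑ f(x₁) g(x₂)`, whose identity element is the counit of `H`. -/
def HDual (k H : Type*) [Field k] [Ring H] [Bialgebra k H] : Type _ := WithConv (H →ₗ[k] k)

variable {k H : Type*} [Field k] [Ring H]

section Algebra

variable [Bialgebra k H]

noncomputable instance instRing : Ring (HDual k H) :=
  inferInstanceAs (Ring (WithConv (H →ₗ[k] k)))

noncomputable instance instAlgebra : Algebra k (HDual k H) :=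
  inferInstanceAs (Algebra k (WithConv (H →ₗ[k] k)))

/-- The identification of `H^*` with the space of linear forms on `H`. -/
noncomputable def toDual (k H : Type*) [Field k] [Ring H] [Bialgebra k H] :
    HDual k H ≃ₗ[k] Module.Dual k H where
  toFun f := WithConv.ofConv f
  invFun f := WithConv.toConv f
  left_inv _ := rfl
  right_inv _ := rfl
  map_add' _ _ := rfl
  map_smul' _ _ := rfl

noncomputable instance instCoeFun : CoeFun (HDual k H) (fun _ => H → k) where
  coe f := toDual k H f

lemma hdual_ext {f g : HDual k H} (h : ∀ x, f x = g x) : f = g :=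
  (toDual k H).injective (LinearMap.ext h)

lemma mul_apply (f g : HDual k H) {x : H} {ι : Type*} (r : Coalgebra.Repr k x ι) :
    (f * g) x = ∑ i ∈ r.index, f (r.left i) * g (r.right i) :=
  r.convMul_apply (WithConv.toConv (toDual k H f)) (WithConv.toConv (toDual k H g))

@[simp]
lemma one_apply (x : H) : (1 : HDual k H) x = counit (R := k) x := rfl

/-- The canonical map `H^* ⊗ H^* → (H ⊗ H)^*`, `(f ⊗ g)(x ⊗ y) = f(x) g(y)`. -/
noncomputable def pairing (k H : Type*) [Field k] [Ring H] [Bialgebra k H] :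
    HDual k H ⊗[k] HDual k H →ₗ[k] Module.Dual k (H ⊗[k] H) :=
  TensorProduct.dualDistrib k H H ∘ₗ
    TensorProduct.map (toDual k H).toLinearMap
      (toDual k H).toLinearMap

@[simp]
lemma pairing_tmul (f g : HDual k H) (x y : H) :
    pairing k H (f ⊗ₜ g) (x ⊗ₜ y) = f x * g y := by
  simp [pairing]

lemma pairing_mul (s t : HDual k H ⊗[k] HDual k H) {x y : H} {ι κ : Type*}
    (rx : Coalgebra.Repr k x ι) (ry : Coalgebra.Repr k y κ) :
    pairing k H (s * t) (x ⊗ₜ y) = ∑ i ∈ rx.index, ∑ j ∈ ry.index,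
      pairing k H s (rx.left i ⊗ₜ ry.left j) * pairing k H t (rx.right i ⊗ₜ ry.right j) := by
  induction s with
  | zero => simp
  | add s₁ s₂ h₁ h₂ =>
    simp only [map_add, LinearMap.add_apply, h₁, h₂, add_mul, Finset.sum_add_distrib]
  | tmul f g =>
    induction t with
    | zero => simp
    | add t₁ t₂ h₁ h₂ =>
      simp only [map_add, LinearMap.add_apply, h₁, h₂, mul_add, Finset.sum_add_distrib]
    | tmul f' g' =>
      rw [Algebra.TensorProduct.tmul_mul_tmul, pairing_tmul, mul_apply _ _ rx, mul_apply _ _ ry,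
        Finset.sum_mul_sum]
      simp only [pairing_tmul]
      refine Finset.sum_congr rfl fun i _ => Finset.sum_congr rfl fun j _ => ?_
      ring

variable [Module.Finite k H]

/-- For finite dimensional `H` the canonical map `H^* ⊗ H^* → (H ⊗ H)^*` is an isomorphism. -/
noncomputable def pairingEquiv (k H : Type*) [Field k] [Ring H] [Bialgebra k H]
    [Module.Finite k H] : (HDual k H ⊗[k] HDual k H) ≃ₗ[k] Module.Dual k (H ⊗[k] H) :=
  TensorProduct.congr (toDual k H) (toDual k H)
    ≪≫ₗ TensorProduct.dualDistribEquiv k H H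

lemma pairingEquiv_apply (t : HDual k H ⊗[k] HDual k H) :
    pairingEquiv k H t = pairing k H t := rfl

lemma pairing_ext {s t : HDual k H ⊗[k] HDual k H}
    (h : ∀ x y, pairing k H s (x ⊗ₜ y) = pairing k H t (x ⊗ₜ y)) : s = t :=
  (pairingEquiv k H).injective (TensorProduct.ext' h)

/-- The comultiplication `μ^*` and the counit `η^*` of `H^*`: the transposes of the
multiplication and of the unit of `H`. Thus `Δ(f) = ∑ f₁ ⊗ f₂` where `f(xy) = ∑ f₁(x) f₂(y)`,
and `ε(f) = f(1)`. -/
noncomputable instance instCoalgebraStruct : CoalgebraStruct k (HDual k H) where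
  comul := (pairingEquiv k H).symm.toLinearMap ∘ₗ (LinearMap.mul' k H).dualMap ∘ₗ
    (toDual k H).toLinearMap
  counit := LinearMap.applyₗ (1 : H) ∘ₗ (toDual k H).toLinearMap

@[simp]
lemma counit_apply (f : HDual k H) : counit (R := k) f = f 1 := rfl

@[simp]
lemma pairing_comul (f : HDual k H) (x y : H) :
    pairing k H (comul (R := k) f) (x ⊗ₜ y) = f (x * y) := by
  rw [← pairingEquiv_apply]
  simp [comul]

/-- `(f ⊗ (g ⊗ h))(x ⊗ (y ⊗ z)) = f(x) g(y) h(z)`. -/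
noncomputable def pairing₃ (k H : Type*) [Field k] [Ring H] [Bialgebra k H]
    [Module.Finite k H] : (HDual k H ⊗[k] (HDual k H ⊗[k] HDual k H)) ≃ₗ[k]
      Module.Dual k (H ⊗[k] (H ⊗[k] H)) :=
  TensorProduct.congr (toDual k H) (pairingEquiv k H)
    ≪≫ₗ TensorProduct.dualDistribEquiv k H (H ⊗[k] H)

lemma pairing₃_tmul (f : HDual k H) (t : HDual k H ⊗[k] HDual k H) (x : H) (u : H ⊗[k] H) :
    pairing₃ k H (f ⊗ₜ t) (x ⊗ₜ u) = f x * pairing k H t u := rfl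

lemma pairing₃_lTensor (t : HDual k H ⊗[k] HDual k H) (x y z : H) :
    pairing₃ k H (comul.lTensor _ t) (x ⊗ₜ (y ⊗ₜ z)) = pairing k H t (x ⊗ₜ (y * z)) := by
  induction t with
  | zero => simp
  | add s t hs ht => simp only [map_add, LinearMap.add_apply, hs, ht]
  | tmul f g => simp [pairing₃_tmul]

lemma pairing₃_assoc (t : HDual k H ⊗[k] HDual k H) (h : HDual k H) (x y z : H) :
    pairing₃ k H (TensorProduct.assoc k _ _ _ (t ⊗ₜ h)) (x ⊗ₜ (y ⊗ₜ z)) =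
      pairing k H t (x ⊗ₜ y) * h z := by
  induction t with
  | zero => simp
  | add s t hs ht =>
    simp only [TensorProduct.add_tmul, map_add, LinearMap.add_apply, hs, ht, add_mul]
  | tmul f g => simp [pairing₃_tmul, mul_assoc]

lemma pairing₃_rTensor (t : HDual k H ⊗[k] HDual k H) (x y z : H) :
    pairing₃ k H (TensorProduct.assoc k _ _ _ (comul.rTensor _ t)) (x ⊗ₜ (y ⊗ₜ z)) =
      pairing k H t ((x * y) ⊗ₜ z) := by
  induction t with
  | zero => simp
  | add s t hs ht => simp only [map_add, LinearMap.add_apply, hs, ht]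
  | tmul f g => simp [pairing₃_assoc]

lemma lid_rTensor_counit (t : HDual k H ⊗[k] HDual k H) (x : H) :
    (TensorProduct.lid k _ ((counit (R := k)).rTensor (HDual k H) t) : HDual k H) x =
      pairing k H t (1 ⊗ₜ x) := by
  induction t with
  | zero => simp
  | add s t hs ht => simp only [map_add, LinearMap.add_apply, hs, ht]
  | tmul f g => simp

lemma rid_lTensor_counit (t : HDual k H ⊗[k] HDual k H) (x : H) :
    (TensorProduct.rid k _ ((counit (R := k)).lTensor (HDual k H) t) : HDual k H) x =
      pairing k H t (x ⊗ₜ 1) := by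
  induction t with
  | zero => simp
  | add s t hs ht => simp only [map_add, LinearMap.add_apply, hs, ht]
  | tmul f g => simp [mul_comm]

noncomputable instance instCoalgebra : Coalgebra k (HDual k H) where
  coassoc := by
    ext f : 1
    apply (pairing₃ k H).injective
    refine TensorProduct.ext (LinearMap.ext fun x => TensorProduct.ext' fun y z => ?_)
    simp [pairing₃_lTensor, pairing₃_rTensor, mul_assoc]
  rTensor_counit_comp_comul := by
    ext f : 1
    apply (TensorProduct.lid k (HDual k H)).injective
    refine hdual_ext fun x => ?_
    simp only [LinearMap.comp_apply, lid_rTensor_counit]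
    simp
  lTensor_counit_comp_comul := by
    ext f : 1
    apply (TensorProduct.rid k (HDual k H)).injective
    refine hdual_ext fun x => ?_
    simp only [LinearMap.comp_apply, rid_lTensor_counit]
    simp

noncomputable instance instBialgebra : Bialgebra k (HDual k H) :=
  Bialgebra.mk' k (HDual k H)
    (by simp)
    (by
      intro f g
      have h1 : comul (R := k) (1 : H) = 1 ⊗ₜ 1 := Bialgebra.comul_one
      let r : Coalgebra.Repr k (1 : H) Unit :=
        { index := {()}, left := fun _ => 1, right := fun _ => 1, eq := by simp [h1] }
      rw [counit_apply, mul_apply f g r]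
      simp [r])
    (by
      refine pairing_ext fun x y => ?_
      simp [Algebra.TensorProduct.one_def])
    (by
      intro f g
      refine pairing_ext fun x y => ?_
      rw [pairing_mul _ _ (ℛ k x) (ℛ k y)]
      simp only [pairing_comul]
      let r : Coalgebra.Repr k (x * y) (_ × _) :=
        { index := (ℛ k x).index ×ˢ (ℛ k y).index
          left := fun p => (ℛ k x).left p.1 * (ℛ k y).left p.2
          right := fun p => (ℛ k x).right p.1 * (ℛ k y).right p.2
          eq := by
            rw [Bialgebra.comul_mul]
            conv_rhs => rw [← (ℛ k x).eq, ← (ℛ k y).eq]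
            rw [Finset.sum_mul_sum, Finset.sum_product]
            simp }
      rw [mul_apply f g r, Finset.sum_product])

end Algebra

section Hopf

variable [HopfAlgebra k H]

/-- The transpose `S^*` of the antipode of `H`. -/
noncomputable def antipodeDual (k H : Type*) [Field k] [Ring H] [HopfAlgebra k H] :
    HDual k H →ₗ[k] HDual k H :=
  (toDual k H).symm.toLinearMap ∘ₗ
    (HopfAlgebra.antipode k (A := H)).dualMap ∘ₗ
      (toDual k H).toLinearMap

@[simp]
lemma antipodeDual_apply (f : HDual k H) (x : H) :
    antipodeDual k H f x = f (HopfAlgebra.antipode k x) := rfl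

lemma mul_rTensor_antipodeDual (t : HDual k H ⊗[k] HDual k H) {x : H} {ι : Type*}
    (r : Coalgebra.Repr k x ι) :
    (LinearMap.mul' k (HDual k H) ((antipodeDual k H).rTensor _ t)) x =
      ∑ i ∈ r.index, pairing k H t (HopfAlgebra.antipode k (r.left i) ⊗ₜ r.right i) := by
  induction t with
  | zero => simp
  | add s t hs ht =>
    simp only [map_add, LinearMap.add_apply, hs, ht, Finset.sum_add_distrib]
  | tmul f g => simp only [LinearMap.rTensor_tmul, LinearMap.mul'_apply, mul_apply _ _ r,
      antipodeDual_apply, pairing_tmul]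

lemma mul_lTensor_antipodeDual (t : HDual k H ⊗[k] HDual k H) {x : H} {ι : Type*}
    (r : Coalgebra.Repr k x ι) :
    (LinearMap.mul' k (HDual k H) ((antipodeDual k H).lTensor _ t)) x =
      ∑ i ∈ r.index, pairing k H t (r.left i ⊗ₜ HopfAlgebra.antipode k (r.right i)) := by
  induction t with
  | zero => simp
  | add s t hs ht =>
    simp only [map_add, LinearMap.add_apply, hs, ht, Finset.sum_add_distrib]
  | tmul f g => simp only [LinearMap.lTensor_tmul, LinearMap.mul'_apply, mul_apply _ _ r,
      antipodeDual_apply, pairing_tmul]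

variable [Module.Finite k H]

/-- The dual Hopf algebra `(H^*, Δ^*, ε^*, μ^*, η^*, S^*)` of a finite dimensional Hopf algebra. -/
noncomputable instance instHopfAlgebra : HopfAlgebra k (HDual k H) where
  antipode := antipodeDual k H
  mul_antipode_rTensor_comul := by
    ext f : 1
    refine hdual_ext fun x => ?_
    simp only [LinearMap.comp_apply, mul_rTensor_antipodeDual _ (ℛ k x), pairing_comul]
    rw [← map_sum, HopfAlgebra.sum_antipode_mul_eq_smul]
    simp [Algebra.algebraMap_eq_smul_one, mul_comm]
  mul_antipode_lTensor_comul := by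
    ext f : 1
    refine hdual_ext fun x => ?_
    simp only [LinearMap.comp_apply, mul_lTensor_antipodeDual _ (ℛ k x), pairing_comul]
    rw [← map_sum, HopfAlgebra.sum_mul_antipode_eq_smul]
    simp [Algebra.algebraMap_eq_smul_one, mul_comm]

end Hopf

instance instFiniteMonoidAlgebra (k G : Type*) [Field k] [Finite G] :
    Module.Finite k (MonoidAlgebra k G) :=
  Module.Finite.equiv (MonoidAlgebra.coeffLinearEquiv k : MonoidAlgebra k G ≃ₗ[k] G →₀ k).symm

/-- The dual group algebra `k[G]^*` of a finite group `G`, with its dual Hopf algebra structure. -/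
abbrev DualGroupAlgebra (k G : Type*) [Field k] [Group G] : Type _ :=
  HDual k (MonoidAlgebra k G)

/-- Isomorphism of Hopf algebras: a bijective linear map compatible with multiplication, unit,
comultiplication, counit and antipode. -/
def HopfIsomorphic (k A B : Type*) [Field k] [Ring A] [Ring B] [HopfAlgebra k A]
    [HopfAlgebra k B] : Prop :=
  ∃ e : A ≃ₐc[k] B, ∀ a : A, e (HopfAlgebra.antipode k a) = HopfAlgebra.antipode k (e a)

end HopfDual

/-! Semisimplicity splits the augmentation ideal off as a left ideal. The component `e` of 1 in the
complement is an integral with ε(e) = 1, and ∑ e₁ ⊗ S(e₂) is then a separability idempotent, which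
forces `H` to be finite dimensional.

From there duality applies. Characters of `H^*` are evaluations at group-likes of `H`, and
characters of `H` are group-likes of `H^*`. So if characters separate points on one side,
group-likes span the other; being linearly independent, they identify it with a group algebra
(`exists_bialgEquiv_monoidAlgebra`).

For `H` commutative, the Jacobson radical vanishes, so characters of `H` separate points, `H^*` is
some `k[G]`, and transposing gives `H ≃ k[G]^*`. For `H` cocommutative, `H^*` is commutative and
Cartier's theorem (`eq_zero_of_forall_algHom`) separates its points: a nonzero tangent vector at a
character, translated to the counit, would be a nonzero primitive element of a finite dimensional
bialgebra, impossible in characteristic zero. -/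

namespace HopfDual

open Coalgebra

/-! ### Integrals, separability and finite dimensionality -/

section Finite

variable {k H : Type*} [Field k] [Ring H] [HopfAlgebra k H]

/-- A semisimple Hopf algebra has a normalized left integral. -/
lemma exists_normalized_integral (k H : Type*) [Field k] [Ring H] [Bialgebra k H]
    [IsSemisimpleRing H] :
    ∃ e : H, counit (R := k) e = 1 ∧ ∀ h : H, h * e = counit (R := k) h • e := by
  obtain ⟨L, hL⟩ := exists_isCompl (RingHom.ker (Bialgebra.counitAlgHom k H) : Ideal H)
  have htop : (1 : H) ∈ RingHom.ker (Bialgebra.counitAlgHom k H) ⊔ L := by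
    rw [hL.sup_eq_top]; trivial
  obtain ⟨a, ha, e, he, hae⟩ := Submodule.mem_sup.mp htop
  have ha' : counit (R := k) a = 0 := ha
  refine ⟨e, ?_, fun h => ?_⟩
  · have := congrArg (counit (R := k)) hae
    simpa [ha'] using this
  -- This difference lies in both complementary left ideals, hence is zero.
  · have hmem : h * e - counit (R := k) h • e ∈ L := by
      refine sub_mem (L.smul_mem h he) ?_
      rw [Algebra.smul_def]
      exact L.smul_mem _ he
    have hker : h * e - counit (R := k) h • e ∈ RingHom.ker (Bialgebra.counitAlgHom k H) := by
      simp [RingHom.mem_ker]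
    have := (Submodule.disjoint_def.mp hL.disjoint) _ hker hmem
    exact sub_eq_zero.mp this

/-- The bilinear map `(x, w) ↦ (x ⊗ 1) * t * (1 ⊗ w)`. -/
noncomputable def sandwich (t : H ⊗[k] H) : H ⊗[k] H →ₗ[k] H ⊗[k] H :=
  LinearMap.mul' k (H ⊗[k] H) ∘ₗ TensorProduct.map
    (LinearMap.mulRight k t ∘ₗ (Algebra.TensorProduct.includeLeft :
      H →ₐ[k] H ⊗[k] H).toLinearMap)
    (Algebra.TensorProduct.includeRight : H →ₐ[k] H ⊗[k] H).toLinearMap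

@[simp]
lemma sandwich_tmul (t : H ⊗[k] H) (x w : H) :
    sandwich t (x ⊗ₜ w) = (x ⊗ₜ 1) * t * (1 ⊗ₜ w) := by
  simp [sandwich]

/-- The antipode reverses products, so multiplying by S(y) on the right of S(b) gives S(yb). -/
lemma sandwich_lTensor_antipode (u s : H ⊗[k] H) :
    sandwich ((HopfAlgebra.antipode k).lTensor H s) ((HopfAlgebra.antipode k).lTensor H u) =
      (HopfAlgebra.antipode k).lTensor H (u * s) := by
  induction u with
  | zero => simp
  | add u v hu hv => simp only [map_add, add_mul, hu, hv]
  | tmul x y =>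
    rw [LinearMap.lTensor_tmul, sandwich_tmul]
    induction s with
    | zero => simp
    | add u v hu hv => simp only [map_add, mul_add, add_mul, hu, hv]
    | tmul a b => simp [HopfAlgebra.antipode_mul_antidistrib]

/-- A left integral `e` gives rise to the Casimir element `∑ e₁ ⊗ S(e₂)`. -/
lemma casimir_of_integral {e : H} (he : ∀ h : H, h * e = counit (R := k) h • e) (h : H) :
    (h ⊗ₜ 1) * (HopfAlgebra.antipode k).lTensor H (comul (R := k) e) =
      (HopfAlgebra.antipode k).lTensor H (comul (R := k) e) * (1 ⊗ₜ[k] h) := by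
  set t := (HopfAlgebra.antipode k).lTensor H (comul (R := k) e) with ht
  have key (h : H) : sandwich t ((HopfAlgebra.antipode k).lTensor H (comul (R := k) h)) =
      counit (R := k) h • t := by
    rw [ht, sandwich_lTensor_antipode, ← Bialgebra.comul_mul, he, map_smul, map_smul]
  -- Ψ(x ⊗ y ⊗ z) = (x ⊗ 1) t (1 ⊗ S(y)z). On h₁ ⊗ h₂ ⊗ h₃, cancelling S(h₂)h₃ leaves (h ⊗ 1) t,
  -- while `key` applied to h₁ ⊗ h₂ leaves t (1 ⊗ h).
  let Ψ : H ⊗[k] (H ⊗[k] H) →ₗ[k] H ⊗[k] H :=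
    sandwich t ∘ₗ (LinearMap.mul' k H ∘ₗ (HopfAlgebra.antipode k).rTensor H).lTensor H
  have hl (u : H ⊗[k] H) : Ψ (comul.lTensor H u) =
      sandwich t (((Algebra.linearMap k H) ∘ₗ counit).lTensor H u) := by
    rw [← HopfAlgebra.mul_antipode_rTensor_comul]
    simp only [Ψ, LinearMap.comp_apply, LinearMap.lTensor_comp]
  have hΨ (v : H ⊗[k] H) (z : H) : Ψ (TensorProduct.assoc k H H H (v ⊗ₜ z)) =
      sandwich t ((HopfAlgebra.antipode k).lTensor H v) * (1 ⊗ₜ z) := by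
    induction v with
    | zero => simp
    | add u v hu hv => simp only [TensorProduct.add_tmul, map_add, add_mul, hu, hv]
    | tmul x y => simp [Ψ, mul_assoc]
  have hr (u : H ⊗[k] H) : Ψ (TensorProduct.assoc k H H H (comul.rTensor H u)) =
      t * (1 ⊗ₜ TensorProduct.lid k H ((counit (R := k)).rTensor H u)) := by
    induction u with
    | zero => simp
    | add u v hu hv => simp only [map_add, TensorProduct.tmul_add, mul_add, hu, hv]
    | tmul x y => simp [hΨ, key]
  have hl' (u : H ⊗[k] H) : sandwich t (((Algebra.linearMap k H) ∘ₗ counit).lTensor H u) =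
      (TensorProduct.rid k H ((counit (R := k)).lTensor H u) ⊗ₜ 1) * t := by
    induction u with
    | zero => simp
    | add u v hu hv => simp only [map_add, TensorProduct.add_tmul, add_mul, hu, hv]
    | tmul x y =>
      simp [Algebra.algebraMap_eq_smul_one, TensorProduct.smul_tmul', ← Algebra.TensorProduct.one_def]
  have := congrArg Ψ (Coalgebra.coassoc_apply (R := k) h)
  rw [hr, hl, hl'] at this
  simpa using this.symm

/-- An algebra over a field with a separability idempotent is finite dimensional. -/
lemma finite_of_separability_idempotent {A : Type*} [Ring A] [Algebra k A] (t : A ⊗[k] A)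
    (ht : LinearMap.mul' k A t = 1) (hcas : ∀ a : A, (a ⊗ₜ 1) * t = t * (1 ⊗ₜ[k] a)) :
    Module.Finite k A := by
  classical
  obtain ⟨s, rfl⟩ := TensorProduct.exists_finset t
  let X : Submodule k A := Submodule.span k (s.image Prod.fst : Set A)
  have : Module.Finite k X := by
    exact Module.Finite.iff_fg.mpr ⟨s.image Prod.fst, by simp [X]⟩
  obtain ⟨p, hp⟩ := X.subtype.exists_leftInverse_of_injective (by simp)
  have hpX (i) (hi : i ∈ s) : ((p i.1 : X) : A) = i.1 := by
    have hi' : i.1 ∈ X := Submodule.subset_span (Finset.mem_image_of_mem _ hi)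
    simpa using congrArg Subtype.val (LinearMap.congr_fun hp ⟨i.1, hi'⟩)
  -- Apply the projection `p` onto the span of the left legs to the first factor of the Casimir
  -- identity, then multiply out. Hence `A` is the finite sum of the spaces X · i.2.
  have hsum (a : A) : a = ∑ i ∈ s, ((p (a * i.1) : X) : A) * i.2 := by
    have h1 := congrArg ((X.subtype ∘ₗ p).rTensor A) (hcas a)
    simp only [Finset.mul_sum, Finset.sum_mul, map_sum, Algebra.TensorProduct.tmul_mul_tmul,
      LinearMap.rTensor_tmul, one_mul, mul_one, LinearMap.comp_apply, Submodule.subtype_apply] at h1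
    have h2 := congrArg (LinearMap.mul' k A) h1
    simp only [map_sum, LinearMap.mul'_apply] at h2 ht
    rw [h2]
    calc a = (∑ i ∈ s, i.1 * i.2) * a := by rw [ht, one_mul]
      _ = _ := by
        rw [Finset.sum_mul]
        exact Finset.sum_congr rfl fun i hi => by rw [hpX i hi, mul_assoc]
  have htop : (⊤ : Submodule k A) = s.sup fun i => X.map (LinearMap.mulRight k i.2) := by
    refine le_antisymm (fun a _ => ?_) le_top
    rw [hsum a]
    refine Submodule.sum_mem _ fun i hi => ?_
    exact Finset.le_sup (f := fun i : A × A => X.map (LinearMap.mulRight k i.2)) hi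
      ⟨_, (p (a * i.1)).2, rfl⟩
  refine ⟨?_⟩
  rw [htop]
  exact Submodule.fg_finset_sup s _ fun i _ => (Module.Finite.iff_fg.mp ‹_›).map _

/-- A semisimple Hopf algebra over a field is finite dimensional. -/
theorem finite_of_isSemisimpleRing (k H : Type*) [Field k] [Ring H] [HopfAlgebra k H]
    [IsSemisimpleRing H] : Module.Finite k H := by
  obtain ⟨e, he, hint⟩ := exists_normalized_integral k H
  refine finite_of_separability_idempotent _ ?_ (casimir_of_integral hint)
  simp [he]

end Finite

/-! ### Absence of primitive elements in characteristic zero -/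

section Primitive

variable {k B : Type*} [Field k] [Ring B] [Bialgebra k B]

instance instFiniteHDual [Module.Finite k B] : Module.Finite k (HDual k B) :=
  Module.Finite.equiv (toDual k B).symm

lemma mul_apply_eq_pairing (f g : HDual k B) (x : B) :
    (f * g) x = pairing k B (f ⊗ₜ g) (comul (R := k) x) := by
  rw [mul_apply f g (ℛ k x)]
  conv_rhs => rw [← (ℛ k x).eq]
  simp

lemma comul_pow_of_primitive {p : B} (hp : comul (R := k) p = p ⊗ₜ 1 + 1 ⊗ₜ p) (n : ℕ) :
    comul (R := k) (p ^ n) =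
      ∑ i ∈ Finset.range (n + 1), (n.choose i : k) • ((p ^ i) ⊗ₜ[k] (p ^ (n - i))) := by
  have hc : Commute (p ⊗ₜ[k] (1 : B)) ((1 : B) ⊗ₜ[k] p) := by
    simp [Commute, SemiconjBy]
  rw [Bialgebra.comul_pow, hp, hc.add_pow]
  refine Finset.sum_congr rfl fun i _ => ?_
  simp [Algebra.TensorProduct.tmul_pow, Nat.cast_smul_eq_nsmul, nsmul_eq_mul, Nat.cast_comm]

/-- The coproduct distributes the `m` copies of `p` among the `n` factors `f`, and a factor
receiving none contributes f(1) = 0. So nothing survives for m < n, and for m = n each factor gets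
exactly one, in n! ways. -/
lemma pow_apply_pow_of_primitive {p : B} (hp : comul (R := k) p = p ⊗ₜ 1 + 1 ⊗ₜ p)
    {f : HDual k B} (hf : f 1 = 0) (n : ℕ) :
    (∀ m < n, (f ^ n) (p ^ m) = 0) ∧ (f ^ n) (p ^ n) = n.factorial * f p ^ n := by
  induction n with
  | zero => simp
  | succ n ih =>
    have hstep (m : ℕ) : (f ^ (n + 1)) (p ^ m) =
        ∑ i ∈ Finset.range (m + 1), (m.choose i : k) * ((f ^ n) (p ^ i) * f (p ^ (m - i))) := by
      rw [pow_succ, mul_apply_eq_pairing, comul_pow_of_primitive hp]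
      simp
    constructor
    · intro m hm
      rw [hstep]
      refine Finset.sum_eq_zero fun i hi => ?_
      rcases (Nat.lt_or_ge i n) with h | h
      · simp [ih.1 i h]
      · have : m - i = 0 := by omega
        simp [this, hf]
    · rw [hstep, Finset.sum_range_succ, Finset.sum_range_succ,
        Finset.sum_eq_zero fun i hi => by simp [ih.1 i (Finset.mem_range.mp hi)]]
      simp [ih.2, hf, Nat.factorial_succ]
      ring

/-- A finite dimensional bialgebra in characteristic zero has no nonzero primitive elements. -/
lemma primitive_eq_zero [CharZero k] [Module.Finite k B] {p : B}
    (hp : comul (R := k) p = p ⊗ₜ 1 + 1 ⊗ₜ p) : p = 0 := by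
  by_contra hne
  obtain ⟨φ, hφ⟩ : ∃ φ : Module.Dual k B, φ p ≠ 0 := by
    by_contra! h
    exact hne ((Module.forall_dual_apply_eq_zero_iff k p).mp h)
  have hε : counit (R := k) p = 0 := by
    have h := Coalgebra.rTensor_counit_comul (R := k) p
    rw [hp] at h
    have h' := congrArg (TensorProduct.lid k B) h
    simp only [map_add, LinearMap.rTensor_tmul, TensorProduct.lid_tmul, Bialgebra.counit_one,
      one_smul, add_eq_right] at h'
    simpa using congrArg (counit (R := k)) h'
  -- The correction makes f(1) = 0 and leaves the value at `p` unchanged, since ε(p) = 0.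
  let f : HDual k B := (toDual k B).symm (φ - φ 1 • counit)
  have hf (x : B) : f x = φ x - φ 1 * counit (R := k) x := rfl
  have hf1 : f 1 = 0 := by simp [hf]
  have hfp : f p ≠ 0 := by simpa [hf, hε] using hφ
  have hint : IsIntegral k p := Algebra.IsIntegral.isIntegral p
  let q := minpoly k p
  -- With d the degree of the minimal polynomial, only its leading term survives under fᵈ, giving d!
  -- f(p)ᵈ = 0.
  have h0 : (f ^ q.natDegree) (Polynomial.aeval p q) = 0 := by
    rw [minpoly.aeval, map_zero]
  rw [Polynomial.aeval_eq_sum_range, map_sum, Finset.sum_range_succ,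
    Finset.sum_eq_zero fun i hi => by
      rw [map_smul, (pow_apply_pow_of_primitive hp hf1 _).1 i (Finset.mem_range.mp hi), smul_zero],
    map_smul, (pow_apply_pow_of_primitive hp hf1 _).2, Polynomial.coeff_natDegree,
    (minpoly.monic hint).leadingCoeff] at h0
  simp [Nat.factorial_ne_zero, hfp] at h0

end Primitive

/-! ### Characters, group-like elements and Cartier's theorem -/

section Separation

variable {k : Type*} [Field k]

/-- Algebra homomorphisms to the base field are group-like elements of the dual. -/
lemma isGroupLikeElem_toDual_symm {A : Type*} [Ring A] [Bialgebra k A] [Module.Finite k A]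
    (g : A →ₐ[k] k) :
    IsGroupLikeElem k ((toDual k A).symm g.toLinearMap) where
  counit_eq_one := map_one g
  comul_eq_tmul_self := pairing_ext fun x y => by
    rw [pairing_comul, pairing_tmul]
    exact map_mul g x y

/-- Algebra homomorphisms from the dual to the base field are evaluations at group-like
elements. -/
lemma exists_isGroupLikeElem_eval {A : Type*} [Ring A] [Bialgebra k A] [Module.Finite k A]
    (φ : HDual k A →ₐ[k] k) : ∃ a : A, IsGroupLikeElem k a ∧ ∀ f : HDual k A, φ f = f a := by
  obtain ⟨a, ha⟩ := (Module.evalEquiv k A).surjective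
    (φ.toLinearMap ∘ₗ (toDual k A).symm.toLinearMap)
  have hφ (f : HDual k A) : φ f = f a := (LinearMap.congr_fun ha (toDual k A f)).symm
  refine ⟨a, ⟨?_, ?_⟩, hφ⟩
  · rw [← one_apply, ← hφ, map_one]
  · have h (t : HDual k A ⊗[k] HDual k A) :
        pairing k A t (comul (R := k) a) = pairing k A t (a ⊗ₜ a) := by
      induction t with
      | zero => simp
      | add s t hs ht => simp only [map_add, LinearMap.add_apply, hs, ht]
      | tmul f g => rw [← mul_apply_eq_pairing, ← hφ, map_mul, hφ, hφ, pairing_tmul]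
    rw [← sub_eq_zero, ← Module.forall_dual_apply_eq_zero_iff k]
    intro ψ
    obtain ⟨t, rfl⟩ := (pairingEquiv k A).surjective ψ
    rw [map_sub, pairingEquiv_apply, h, sub_self]

/-- In characteristic zero the kernel of a character of a finite dimensional commutative Hopf
algebra is idempotent. -/
lemma isIdempotentElem_ker [CharZero k] {A : Type*} [CommRing A] [HopfAlgebra k A]
    [Module.Finite k A] (g : A →ₐ[k] k) : IsIdempotentElem (RingHom.ker g) := by
  refine le_antisymm Ideal.mul_le_left fun x hx => ?_
  by_contra hxM
  set M : Ideal A := RingHom.ker g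
  let V : Submodule k A := (M * M).restrictScalars k
  obtain ⟨ψ, hψx, hψ⟩ := Submodule.exists_le_ker_of_notMem (v := x) (p := V) hxM
  let γ : HDual k A := (toDual k A).symm g.toLinearMap
  have hγ : IsGroupLikeElem k γ := isGroupLikeElem_toDual_symm g
  -- Normalized to vanish at 1 while still killing M², this functional is a derivation at the point
  -- `g`. It agrees with `ψ` on `M`.
  let ξ : HDual k A := (toDual k A).symm (ψ - ψ 1 • g.toLinearMap)
  have hξ (a : A) : ξ a = ψ a - ψ 1 * g a := rfl
  have hγa (a : A) : γ a = g a := rfl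
  have hder (a b : A) : ξ (a * b) = ξ a * g b + g a * ξ b := by
    have hmem : (a - algebraMap k A (g a)) * (b - algebraMap k A (g b)) ∈ V :=
      Ideal.mul_mem_mul (by simp [M, RingHom.mem_ker]) (by simp [M, RingHom.mem_ker])
    have h0 : ψ ((a - algebraMap k A (g a)) * (b - algebraMap k A (g b))) = 0 := hψ hmem
    have hexp : (a - algebraMap k A (g a)) * (b - algebraMap k A (g b)) =
        a * b - g b • a - g a • b + (g a * g b) • 1 := by
      simp only [Algebra.smul_def, map_mul]
      ring
    rw [hexp] at h0
    simp only [map_add, map_sub, map_smul, smul_eq_mul] at h0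
    simp only [hξ, map_mul]
    linear_combination h0
  have hcomul : comul (R := k) ξ = ξ ⊗ₜ γ + γ ⊗ₜ ξ := pairing_ext fun a b => by
    rw [pairing_comul, map_add, LinearMap.add_apply, pairing_tmul, pairing_tmul, hder, hγa, hγa]
  -- The inverse of the group-like `γ`; multiplying by it moves the tangent vector `ξ` from `g` to
  -- the counit, where it becomes primitive.
  set δ : HDual k A := HopfAlgebra.antipode k γ
  have hδ : comul (R := k) δ = δ ⊗ₜ δ := hγ.antipode.comul_eq_tmul_self
  have hprim : comul (R := k) (ξ * δ) = (ξ * δ) ⊗ₜ 1 + 1 ⊗ₜ (ξ * δ) := by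
    rw [Bialgebra.comul_mul, hcomul, hδ, add_mul, Algebra.TensorProduct.tmul_mul_tmul,
      Algebra.TensorProduct.tmul_mul_tmul, hγ.mul_antipode_cancel]
  have hzero : ξ = 0 := by
    calc ξ = ξ * δ * γ := by rw [mul_assoc, hγ.antipode_mul_cancel, mul_one]
      _ = 0 := by rw [primitive_eq_zero hprim, zero_mul]
  have hgx : g x = 0 := hx
  apply hψx
  have := hξ x
  rw [hgx, mul_zero, sub_zero, hzero] at this
  simpa using this.symm

/-- Over an algebraically closed field every maximal ideal of a finite dimensional commutative
algebra is the kernel of a character. -/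
lemma exists_ker_eq_of_isMaximal [IsAlgClosed k] {A : Type*} [CommRing A] [Algebra k A]
    [Module.Finite k A] (M : Ideal A) [hM : M.IsMaximal] :
    ∃ g : A →ₐ[k] k, RingHom.ker g = M := by
  let _ : Field (A ⧸ M) := Ideal.Quotient.field M
  have hbij : Function.Bijective (algebraMap k (A ⧸ M)) :=
    IsAlgClosed.algebraMap_bijective_of_isIntegral
  let e : k ≃ₐ[k] A ⧸ M := AlgEquiv.ofBijective (Algebra.ofId k (A ⧸ M)) hbij
  refine ⟨e.symm.toAlgHom.comp (Ideal.Quotient.mkₐ k M), ?_⟩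
  ext x
  rw [RingHom.mem_ker]
  change e.symm (Ideal.Quotient.mk M x) = 0 ↔ _
  rw [EmbeddingLike.map_eq_zero_iff, Ideal.Quotient.eq_zero_iff_mem]

/-- Cartier's theorem in the finite dimensional case: the characters of a finite dimensional
commutative Hopf algebra over an algebraically closed field of characteristic zero separate its
elements. -/
theorem eq_zero_of_forall_algHom [CharZero k] [IsAlgClosed k] {A : Type*} [CommRing A]
    [HopfAlgebra k A] [Module.Finite k A] {x : A} (hx : ∀ g : A →ₐ[k] k, g x = 0) : x = 0 := by
  have : IsNoetherianRing A := isNoetherian_of_tower k inferInstance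
  by_contra hne
  have hann : Ideal.span {x} ≠ ⊥ := by simpa using hne
  -- `M` is generated by an idempotent `e`. As x ∈ M is a multiple of `e`, 1 - e annihilates `x` and
  -- so lies in `M` along with `e`, a contradiction.
  obtain ⟨M, hM, hle⟩ := Ideal.exists_le_maximal (Submodule.annihilator (Ideal.span {x}))
    (by rwa [Ne, Submodule.annihilator_eq_top_iff])
  obtain ⟨g, rfl⟩ := exists_ker_eq_of_isMaximal (k := k) M
  obtain ⟨e, he, hspan⟩ := (Ideal.isIdempotentElem_iff_of_fg _
    (IsNoetherian.noetherian (RingHom.ker g))).mp (isIdempotentElem_ker g)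
  have hxe : x ∈ Ideal.span {e} := by
    have hxg : x ∈ RingHom.ker g := hx g
    rwa [hspan] at hxg
  obtain ⟨y, rfl⟩ := Ideal.mem_span_singleton.mp hxe
  have h1 : (1 - e) ∈ RingHom.ker g := by
    refine hle (Submodule.mem_annihilator_span_singleton _ _ |>.mpr ?_)
    rw [smul_eq_mul, ← mul_assoc, sub_mul, one_mul, he.eq, sub_self, zero_mul]
  have h2 : e ∈ RingHom.ker g := by rw [hspan]; exact Submodule.mem_span_singleton_self e
  exact hM.ne_top ((Ideal.eq_top_iff_one _).mpr (by simpa using add_mem h1 h2))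

/-- The characters of a finite dimensional commutative semisimple algebra over an algebraically
closed field separate its elements. -/
lemma eq_zero_of_forall_algHom_of_isSemisimpleRing [IsAlgClosed k] {A : Type*} [CommRing A]
    [Algebra k A] [Module.Finite k A] [IsSemisimpleRing A] {x : A}
    (hx : ∀ g : A →ₐ[k] k, g x = 0) : x = 0 := by
  have hmem : x ∈ Ring.jacobson A := by
    refine Ideal.mem_sInf.mpr fun {M} hM => ?_
    have : M.IsMaximal := ⟨hM⟩
    obtain ⟨g, rfl⟩ := exists_ker_eq_of_isMaximal (k := k) M
    exact hx g
  rwa [IsSemisimpleRing.jacobson_eq_bot] at hmem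

end Separation

/-! ### Group-like elements and group algebras -/

section GroupLike

variable {k : Type*} [Field k]

/-- If the characters of the dual of `H` separate its elements, then `H` is spanned by group-like
elements. -/
lemma span_groupLike_eq_top {H : Type*} [Ring H] [Bialgebra k H] [Module.Finite k H]
    (h : ∀ f : HDual k H, (∀ φ : HDual k H →ₐ[k] k, φ f = 0) → f = 0) :
    Submodule.span k {a : H | IsGroupLikeElem k a} = ⊤ := by
  by_contra hne
  -- A functional vanishing on all group-likes is an element of the dual killed by every character.
  obtain ⟨ψ, hψ0, hψ⟩ := Submodule.exists_le_ker_of_lt_top _ (lt_top_iff_ne_top.mpr hne)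
  refine hψ0 ((toDual k H).symm.map_eq_zero_iff.mp (h _ fun φ => ?_))
  obtain ⟨a, ha, hφ⟩ := exists_isGroupLikeElem_eval φ
  rw [hφ]
  exact hψ (Submodule.subset_span ha)

/-- If the characters of `H` separate its elements, then the dual of `H` is spanned by group-like
elements. -/
lemma span_groupLike_hdual_eq_top {H : Type*} [Ring H] [Bialgebra k H] [Module.Finite k H]
    (h : ∀ x : H, (∀ φ : H →ₐ[k] k, φ x = 0) → x = 0) :
    Submodule.span k {f : HDual k H | IsGroupLikeElem k f} = ⊤ := by
  by_contra hne
  obtain ⟨ψ, hψ0, hψ⟩ := Submodule.exists_le_ker_of_lt_top _ (lt_top_iff_ne_top.mpr hne)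
  obtain ⟨x, hx⟩ := (Module.evalEquiv k H).surjective (ψ ∘ₗ (toDual k H).symm.toLinearMap)
  have hψx (f : HDual k H) : ψ f = f x := (LinearMap.congr_fun hx (toDual k H f)).symm
  have hx0 : x = 0 := h x fun φ => by
    have : ψ ((toDual k H).symm φ.toLinearMap) = 0 :=
      hψ (Submodule.subset_span (isGroupLikeElem_toDual_symm φ))
    rwa [hψx] at this
  exact hψ0 (LinearMap.ext fun f => by simp [hψx, hx0])

lemma finite_groupLike {B : Type*} [AddCommGroup B] [Module k B] [Coalgebra k B]
    [Module.Finite k B] : Finite (GroupLike k B) :=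
  (linearIndep_groupLikeVal (R := k) (A := B)).finite

/-- A finite dimensional Hopf algebra spanned by group-like elements is a group algebra. -/
lemma exists_bialgEquiv_monoidAlgebra {B : Type*} [Ring B] [HopfAlgebra k B] [Module.Finite k B]
    (h : Submodule.span k {a : B | IsGroupLikeElem k a} = ⊤) :
    ∃ (G : Type) (_ : Group G) (_ : Finite G), Nonempty (MonoidAlgebra k G ≃ₐc[k] B) := by
  have : Finite (GroupLike k B) := finite_groupLike
  have hval (x : MonoidAlgebra k (GroupLike k B)) :
      MonoidAlgebra.liftGroupLikeBialgHom (R := k) (A := B) x =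
        Finsupp.linearCombination k (GroupLike.val (R := k) (A := B)) x.coeff := by
    induction x using MonoidAlgebra.induction_linear with
    | zero => simp
    | add x y hx hy => rw [map_add, hx, hy, MonoidAlgebra.coeff_add, map_add]
    | single g r => simp [MonoidAlgebra.liftGroupLikeBialgHom, Algebra.smul_def]
  have hbij : Function.Bijective (MonoidAlgebra.liftGroupLikeBialgHom (R := k) (A := B)) := by
    constructor
    · intro x y hxy
      rw [hval, hval] at hxy
      exact MonoidAlgebra.coeff_injective
        ((linearIndep_groupLikeVal (R := k) (A := B)) hxy)
    · intro b
      have hr : Set.range (GroupLike.val (R := k) (A := B)) = {a : B | IsGroupLikeElem k a} := by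
        ext a
        exact ⟨by rintro ⟨g, rfl⟩; exact g.2, fun ha => ⟨⟨a, ha⟩, rfl⟩⟩
      have hb : b ∈ Submodule.span k (Set.range (GroupLike.val (R := k) (A := B))) := by
        rw [hr, h]; trivial
      obtain ⟨c, hc⟩ := (Finsupp.mem_span_range_iff_exists_finsupp).mp hb
      exact ⟨.ofCoeff c, by rw [hval]; exact hc⟩
  -- Finiteness of the group allows a copy of it in `Type`.
  exact ⟨Shrink.{0} (GroupLike k B), inferInstance, inferInstance,
    ⟨(MonoidAlgebra.domCongrBialgEquiv k k (Shrink.mulEquiv.{0} (α := GroupLike k B))).trans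
      (BialgEquiv.ofBijective _ hbij)⟩⟩

/-- Bialgebra homomorphisms between Hopf algebras commute with the antipodes. -/
lemma map_antipode {A B : Type*} [Ring A] [Ring B] [HopfAlgebra k A] [HopfAlgebra k B]
    (e : A →ₐc[k] B) (a : A) :
    e (HopfAlgebra.antipode k a) = HopfAlgebra.antipode k (e a) := by
  -- e ∘ S and S ∘ e are a left and a right convolution inverse of `e`, hence equal.
  let l : WithConv (A →ₗ[k] B) := .toConv ((e : A →ₐ[k] B).toLinearMap ∘ₗ HopfAlgebra.antipode k)
  let m : WithConv (A →ₗ[k] B) := .toConv (e : A →ₐ[k] B).toLinearMap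
  let r : WithConv (A →ₗ[k] B) := .toConv (HopfAlgebra.antipode k ∘ₗ (e : A →ₐ[k] B).toLinearMap)
  have hl : l * m = 1 := by
    have h := LinearMap.algHom_comp_convMul_distrib (e : A →ₐ[k] B)
      (.toConv (HopfAlgebra.antipode k (A := A))) (.toConv LinearMap.id)
    rw [LinearMap.antipode_mul_id] at h
    refine WithConv.ext (Eq.trans h.symm ?_)
    ext x
    simpa [LinearMap.convOne_def] using AlgHomClass.commutes e (counit (R := k) x)
  have hr : m * r = 1 := by
    have h := LinearMap.convMul_comp_coalgHom_distrib (.toConv LinearMap.id)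
      (.toConv (HopfAlgebra.antipode k (A := B))) (e : A →ₗc[k] B)
    rw [LinearMap.id_mul_antipode] at h
    refine WithConv.ext (Eq.trans h.symm ?_)
    ext x
    simp [LinearMap.convOne_def]
  exact LinearMap.congr_fun (congrArg WithConv.ofConv (left_inv_eq_right_inv hl hr)) a

lemma hopfIsomorphic_of_bialgEquiv {A B : Type*} [Ring A] [Ring B] [HopfAlgebra k A]
    [HopfAlgebra k B] (e : A ≃ₐc[k] B) : HopfIsomorphic k A B :=
  ⟨e, fun a => map_antipode (e : A →ₐc[k] B) a⟩

end GroupLike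

/-! ### Transposing isomorphisms -/

section Transpose

variable {k H B : Type*} [Field k] [Ring H] [Bialgebra k H] [Ring B]
  [Bialgebra k B]

/-- The transpose `H → B^*` of a linear map `B → H^*`. -/
noncomputable def transpose (e : B →ₗ[k] HDual k H) : H →ₗ[k] HDual k B :=
  (toDual k B).symm.toLinearMap ∘ₗ ((toDual k H).toLinearMap ∘ₗ e).flip

@[simp]
lemma transpose_apply (e : B →ₗ[k] HDual k H) (x : H) (b : B) :
    (transpose e x : HDual k B) b = e b x := rfl

/-- This adjunction and the next trade structure across the transpose: multiplicativity of `e`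
becomes comultiplicativity here, and conversely in `pairing_map_apply`. -/
lemma pairing_map_transpose (e : B →ₗ[k] HDual k H) (u : H ⊗[k] H) (a b : B) :
    pairing k B (TensorProduct.map (transpose e) (transpose e) u) (a ⊗ₜ b) =
      pairing k H (e a ⊗ₜ e b) u := by
  induction u with
  | zero => simp
  | add u v hu hv => simp only [map_add, LinearMap.add_apply, hu, hv]
  | tmul x y => simp

lemma pairing_map_apply (e : B →ₗ[k] HDual k H) (u : B ⊗[k] B) (x y : H) :
    pairing k H (TensorProduct.map e e u) (x ⊗ₜ y) =
      pairing k B (transpose e x ⊗ₜ transpose e y) u := by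
  induction u with
  | zero => simp
  | add u v hu hv => simp only [map_add, LinearMap.add_apply, hu, hv]
  | tmul a b => simp

/-- The transpose of an isomorphism `B ≃ H^*` is an isomorphism `H ≃ B^*`. -/
lemma nonempty_bialgEquiv_transpose [Module.Finite k H] [Module.Finite k B]
    (e : B ≃ₐc[k] HDual k H) : Nonempty (H ≃ₐc[k] HDual k B) := by
  let l : B →ₗ[k] HDual k H := (e : B →ₐ[k] HDual k H).toLinearMap
  have hl (b : B) : l b = e b := rfl
  let F : H →ₐ[k] HDual k B := AlgHom.ofLinearMap (transpose l)
    (hdual_ext fun b => by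
      rw [transpose_apply, hl, one_apply, ← counit_apply]
      exact CoalgHomClass.counit_comp_apply e b)
    (fun x y => hdual_ext fun b => by
      rw [transpose_apply, mul_apply_eq_pairing, ← pairing_map_apply, ← pairing_comul]
      congr 2
      exact (CoalgHomClass.map_comp_comul_apply e b).symm)
  have hF (x : H) (b : B) : (F x) b = e b x := rfl
  let F' : H →ₐc[k] HDual k B := BialgHom.ofAlgHom F
    (AlgHom.ext fun x => by
      change (F x) 1 = counit x
      rw [hF, map_one, one_apply])
    (AlgHom.ext fun x => pairing_ext fun a b => by
      change pairing k B (TensorProduct.map (transpose l) (transpose l) (comul x)) _ =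
        pairing k B (comul (F x)) _
      rw [pairing_map_transpose, pairing_comul, hF, map_mul, mul_apply_eq_pairing, hl, hl])
  have hinj : Function.Injective F' := by
    refine (injective_iff_map_eq_zero F').mpr fun x hx => ?_
    -- Surjectivity of `e` makes every functional on `H` of the form `e b`, so an `x` in the kernel
    -- is killed by all of them.
    refine (Module.forall_dual_apply_eq_zero_iff k x).mp fun φ => ?_
    have h := hF x (e.symm ((toDual k H).symm φ))
    rw [show F x = 0 from hx, BialgEquiv.apply_symm_apply] at h
    simpa using h.symm
  have hrank : Module.finrank k H = Module.finrank k (HDual k B) := by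
    rw [(toDual k B).finrank_eq, Subspace.dual_finrank_eq,
      (e : B ≃ₐ[k] HDual k H).toLinearEquiv.finrank_eq, (toDual k H).finrank_eq,
      Subspace.dual_finrank_eq]
  exact ⟨BialgEquiv.ofBijective F' ⟨hinj,
    (LinearMap.injective_iff_surjective_of_finrank_eq_finrank hrank
      (f := (F' : H →ₐ[k] HDual k B).toLinearMap)).mp hinj⟩⟩

end Transpose

end HopfDual

theorem mainTheorem5 {k : Type*} [Field k] [CharZero k] [IsAlgClosed k]
    {H : Type*} [Ring H] [HopfAlgebra k H] [IsSemisimpleRing H] :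
    ((∀ a b : H, a * b = b * a) →
      ∃ (G : Type) (_ : Group G) (_ : Finite G),
        HopfDual.HopfIsomorphic k H (HopfDual.DualGroupAlgebra k G)) ∧
    (Coalgebra.IsCocomm k H →
      ∃ (G : Type) (_ : Group G) (_ : Finite G),
        HopfDual.HopfIsomorphic k H (MonoidAlgebra k G)) := by
  have hfin : Module.Finite k H := HopfDual.finite_of_isSemisimpleRing k H
  constructor
  · intro hcomm
    have hsep (x : H) (hx : ∀ g : H →ₐ[k] k, g x = 0) : x = 0 := by
      let _ : CommRing H := { ‹Ring H› with mul_comm := hcomm }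
      exact HopfDual.eq_zero_of_forall_algHom_of_isSemisimpleRing hx
    obtain ⟨G, hG, hGfin, ⟨e⟩⟩ := HopfDual.exists_bialgEquiv_monoidAlgebra
      (HopfDual.span_groupLike_hdual_eq_top hsep)
    obtain ⟨e'⟩ := HopfDual.nonempty_bialgEquiv_transpose e
    exact ⟨G, hG, hGfin, HopfDual.hopfIsomorphic_of_bialgEquiv e'⟩
  · intro hco
    have hsep (f : HopfDual.HDual k H) (hf : ∀ φ : HopfDual.HDual k H →ₐ[k] k, φ f = 0) :
        f = 0 := by
      let _ : CommRing (HopfDual.HDual k H) :=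
        { HopfDual.instRing with
          -- Convolution is commutative because `H` is cocommutative.
          mul_comm := fun f g => mul_comm (G := WithConv (H →ₗ[k] k)) f g }
      exact HopfDual.eq_zero_of_forall_algHom hf
    obtain ⟨G, hG, hGfin, ⟨e⟩⟩ := HopfDual.exists_bialgEquiv_monoidAlgebra
      (HopfDual.span_groupLike_eq_top hsep)
    exact ⟨G, hG, hGfin, HopfDual.hopfIsomorphic_of_bialgEquiv e.symm⟩
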